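/- Let $\tfrac12\le H_1<H_2<1$ and $T>0$. Let $\mathrm B(a,b)=\int_0^1x^{a-1}(1-x)^{b-1}\,dx$ and $\beta_{H}=\bigl(H(2H-1)/\mathrm B(H-\tfrac12,2-2H)\bigr)^{1/2}$, and for $0<s<t$ put $$K_{H_1,H_2}(t,s)=\beta_{H_2}\,s^{1/2-H_2}\int_s^t (t-w)^{1/2-H_1}\,w^{H_2-H_1}\,(w-s)^{H_2-3/2}\,dw .$$ For $s,u>0$, $s\ne u$, put $$k(s,u)=\int_0^{s\wedge u}\partial_sK_{H_1,H_2}(s,v)\,\partial_uK_{H_1,H_2}(u,v)\,dv,\qquad \kappa(s,u)=u^{2H_1-1}k(s,u),$$ and $\kappa(s,0)=\lim_{u\downarrow0}\kappa(s,u)$ for $s>0$. (The values of $\kappa$ on the diagonal $s=u$ and at $s=0$ play no role.) Then all these objects are well defined (the integrals converge, $K_{H_1,H_2}(\cdot,v)$ is differentiable at every $t>v>0$, and the limit exists), $\kappa(\cdot,u)\in L_1[0,T]$ for every $u\in[0,T]$, and $$(\kappa x)(u)=\int_0^T\kappa(s,u)\,x(s)\,ds,\qquad u\in[0,T],$$ defines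 a compact linear operator $\kappa\colon C[0,T]\to C[0,T]$, where $C[0,T]$ is the space of real continuous functions on $[0,T]$ with the supremum norm. -/

import Mathlib

open MeasureTheory Filter Topology

noncomputable section

/-- Euler's beta function `B(a, b) = ∫₀¹ x^(a-1) (1-x)^(b-1) dx`, used here for `a, b > 0`. -/
def eulerBeta (a b : ℝ) : ℝ :=
  ∫ x in (0 : ℝ)..1, x ^ (a - 1) * (1 - x) ^ (b - 1)

/-- The normalizing constant `β_H = (H (2H - 1) / B(H - 1/2, 2 - 2H))^(1/2)`. -/
def betaConst (H : ℝ) : ℝ :=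
  Real.sqrt (H * (2 * H - 1) / eulerBeta (H - 1 / 2) (2 - 2 * H))

/-- The integrand `w ↦ (t-w)^(1/2-H₁) w^(H₂-H₁) (w-s)^(H₂-3/2)` in the kernel `K_{H₁,H₂}(t,s)`. -/
def fbmIntegrand (H₁ H₂ t s w : ℝ) : ℝ :=
  (t - w) ^ (1 / 2 - H₁) * w ^ (H₂ - H₁) * (w - s) ^ (H₂ - 3 / 2)

/-- The fractional-Brownian-type kernel
`K_{H₁,H₂}(t,s) = β_{H₂} s^(1/2-H₂) ∫_s^t (t-w)^(1/2-H₁) w^(H₂-H₁) (w-s)^(H₂-3/2) dw`,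
for `0 < s < t`. -/
def fbmKernel (H₁ H₂ t s : ℝ) : ℝ :=
  betaConst H₂ * s ^ (1 / 2 - H₂) * ∫ w in s..t, fbmIntegrand H₁ H₂ t s w

/-- The derivative `∂_t K_{H₁,H₂}(t,v)` in the first variable. -/
def fbmKernelDeriv (H₁ H₂ t v : ℝ) : ℝ :=
  deriv (fun τ : ℝ => fbmKernel H₁ H₂ τ v) t

/-- The kernel `k(s,u) = ∫₀^{s ∧ u} ∂_s K_{H₁,H₂}(s,v) ∂_u K_{H₁,H₂}(u,v) dv`. -/
def kKernel (H₁ H₂ s u : ℝ) : ℝ :=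
  ∫ v in (0 : ℝ)..min s u, fbmKernelDeriv H₁ H₂ s v * fbmKernelDeriv H₁ H₂ u v

/-- The kernel `κ(s,u) = u^(2H₁-1) k(s,u)` for `u > 0`. On the null set `u = 0`, where `k` is an
integral over an empty interval, `κ(s,0)` is the limit of `κ(s,u)` as `u ↓ 0`. -/
def kappa (H₁ H₂ s u : ℝ) : ℝ :=
  if u = 0 then limUnder (𝓝[>] (0 : ℝ)) (fun w : ℝ => w ^ (2 * H₁ - 1) * kKernel H₁ H₂ s w)
  else u ^ (2 * H₁ - 1) * kKernel H₁ H₂ s u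

end

/-! Write γ = H₂ - H₁ > 0. Everything rests on homogeneity. The substitution w = v + (t-v)r moves
the defining integral of K to the unit interval, where it can be differentiated in t. Scaling then
gives ∂ₜK(t,v) = β v^(1/2-H₂) t^(2γ-1) φ(v/t), where φ is `fbmProfile`, continuous on [0,1) and
bounded by a multiple of (1-x)^(γ-1) (`hasDerivAt_fbmKernel`, `fbmProfile_nonneg_le`). Putting v =
ux in the integral for k gives κ(s,u) = s^(2γ-1) g(u/s) for u < s, and a similar formula with the
extra factor (s/u)^(1-2H₁) for s < u. The function g is `kappaProfile`; it is again continuous on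
[0,1) and at most C(1-r)^(γ-1). Continuity of g at 0 yields the limit κ(s,0).

Compactness follows by Arzelà–Ascoli once u ↦ κ(·,u) is continuous into L¹. The singularity at s = u
moves with u, so no fixed integrable function is available from the bounds on κ. Instead κ(·,u) lies
below `kappaMajorant`, which varies with u but has an explicit integral continuous in u;
`tendsto_integral_abs_sub_of_le` turns this into L¹-continuity. -/

/-! ### Beta-type integrability and affine substitution -/

theorem intervalIntegrable_one_sub_rpow_mul_rpow {p q : ℝ} (hp : -1 < p) (hq : -1 < q) :
    IntervalIntegrable (fun r : ℝ => (1 - r) ^ p * r ^ q) volume 0 1 := by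
  -- On the left half only the singularity at 0 matters; the right half is its mirror image under r
  -- ↦ 1 - r with p and q exchanged.
  have key : ∀ {p q : ℝ}, -1 < q →
      IntervalIntegrable (fun r : ℝ => (1 - r) ^ p * r ^ q) volume 0 (1 / 2) := by
    intro p q hq
    refine (intervalIntegral.intervalIntegrable_rpow' hq).continuousOn_mul ?_
    intro r hr
    rw [Set.uIcc_of_le (by norm_num)] at hr
    refine ContinuousAt.continuousWithinAt (ContinuousAt.rpow_const (by fun_prop) (Or.inl ?_))
    have := hr.2
    intro h
    linarith
  refine (key hq).trans ?_
  have h := ((key (p := q) hp).comp_sub_left 1).symm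
  norm_num at h
  norm_num
  simpa only [mul_comm] using h

theorem intervalIntegrable_of_comp_add_mul {f : ℝ → ℝ} {c d : ℝ} (hc : c ≠ 0)
    (h : IntervalIntegrable (fun r : ℝ => f (d + c * r)) volume 0 1) :
    IntervalIntegrable f volume d (d + c) := by
  have h1 : IntervalIntegrable (fun r : ℝ => f (d + r)) volume 0 c := by
    rw [← IntervalIntegrable.comp_mul_left_iff hc]
    simpa [hc] using h
  have h2 := h1.comp_add_left (-d)
  simpa [add_comm] using h2

theorem integral_eq_mul_integral_comp_add_mul (f : ℝ → ℝ) (c d : ℝ) :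
    ∫ w in d..(d + c), f w = c * ∫ r in (0 : ℝ)..1, f (d + c * r) := by
  simp

/-! ### L¹-continuous kernels and compactness -/

/-- A version of dominated convergence in which the dominating function varies with the
parameter. -/
theorem tendsto_integral_abs_sub_of_le {X α : Type*} [TopologicalSpace X]
    [FirstCountableTopology X] [MeasurableSpace α] {μ : Measure α} {K M : X → α → ℝ} {x₀ : X}
    (hK : ∀ x, Integrable (K x) μ) (hM : ∀ x, Integrable (M x) μ)
    (hnonneg : ∀ x, ∀ᵐ a ∂μ, 0 ≤ K x a) (hle : ∀ x, ∀ᵐ a ∂μ, K x a ≤ M x a)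
    (hcK : ∀ᵐ a ∂μ, ContinuousAt (fun x => K x a) x₀)
    (hcM : ∀ᵐ a ∂μ, ContinuousAt (fun x => M x a) x₀)
    (hint : ContinuousAt (fun x => ∫ a, M x a ∂μ) x₀) :
    Tendsto (fun x => ∫ a, |K x a - K x₀ a| ∂μ) (𝓝 x₀) (𝓝 0) := by
  -- Scheffé's argument: since M x ≥ 0, this positive part is dominated by the fixed function M x₀.
  have hpos : Tendsto (fun x => ∫ a, max (M x₀ a - M x a) 0 ∂μ) (𝓝 x₀) (𝓝 0) := by
    rw [show 𝓝 (0 : ℝ) = 𝓝 (∫ _, (0 : ℝ) ∂μ) by simp]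
    refine tendsto_integral_filter_of_dominated_convergence (M x₀) ?_ ?_ (hM x₀) ?_
    · exact Eventually.of_forall fun x => (((hM x₀).sub (hM x)).pos_part).aestronglyMeasurable
    · refine Eventually.of_forall fun x => ?_
      filter_upwards [hnonneg x, hle x, hnonneg x₀, hle x₀] with a h1 h2 h3 h4
      rw [Real.norm_of_nonneg (le_max_right _ _)]
      exact max_le (by linarith) (by linarith)
    · filter_upwards [hcM] with a ha
      have h := (ha.tendsto.const_sub (M x₀ a)).max (tendsto_const_nhds (x := (0 : ℝ)))
      simpa using h
  -- As |y| = 2 max(-y, 0) + y, convergence of the integrals of M supplies the remaining half.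
  have habs : Tendsto (fun x => ∫ a, |M x a - M x₀ a| ∂μ) (𝓝 x₀) (𝓝 0) := by
    have heq : ∀ x, ∫ a, |M x a - M x₀ a| ∂μ
        = 2 * ∫ a, max (M x₀ a - M x a) 0 ∂μ + (∫ a, M x a ∂μ - ∫ a, M x₀ a ∂μ) := by
      intro x
      have h1 : Integrable (fun a => max (M x₀ a - M x a) 0) μ := ((hM x₀).sub (hM x)).pos_part
      have h2 : Integrable (fun a => M x a - M x₀ a) μ := (hM x).sub (hM x₀)
      rw [← integral_sub (hM x) (hM x₀), ← integral_const_mul, ← integral_add (h1.const_mul 2) h2]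
      refine integral_congr_ae (Eventually.of_forall fun a => ?_)
      dsimp only
      rcases le_total (M x a) (M x₀ a) with h | h
      · rw [abs_of_nonpos (by linarith), max_eq_left (by linarith)]; ring
      · rw [abs_of_nonneg (by linarith), max_eq_right (by linarith)]; ring
    simp_rw [heq]
    have h := (hpos.const_mul 2).add (hint.tendsto.sub_const (∫ a, M x₀ a ∂μ))
    simpa using h
  -- Truncated at M x₀, the kernel has a fixed dominating function. The part cut off is at most |M x
  -- - M x₀|, because K x ≤ M x.
  have hmin : Tendsto (fun x => ∫ a, |min (K x a) (M x₀ a) - K x₀ a| ∂μ) (𝓝 x₀) (𝓝 0) := by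
    rw [show 𝓝 (0 : ℝ) = 𝓝 (∫ _, (0 : ℝ) ∂μ) by simp]
    refine tendsto_integral_filter_of_dominated_convergence (M x₀) ?_ ?_ (hM x₀) ?_
    · exact Eventually.of_forall fun x =>
        ((((hK x).inf (hM x₀)).sub (hK x₀)).abs).aestronglyMeasurable
    · refine Eventually.of_forall fun x => ?_
      filter_upwards [hnonneg x, hnonneg x₀, hle x₀] with a h1 h3 h4
      have h5 : 0 ≤ min (K x a) (M x₀ a) := le_min h1 (h3.trans h4)
      have h6 : min (K x a) (M x₀ a) ≤ M x₀ a := min_le_right _ _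
      rw [Real.norm_of_nonneg (abs_nonneg _), abs_le]
      constructor <;> linarith
    · filter_upwards [hcK, hle x₀] with a ha hb
      have h := ((ha.tendsto.min (tendsto_const_nhds (x := M x₀ a))).sub_const (K x₀ a)).abs
      simpa [min_eq_left hb] using h
  refine squeeze_zero (fun x => integral_nonneg fun a => abs_nonneg _) (fun x => ?_)
    (by simpa using hmin.add habs)
  have hi1 : Integrable (fun a => |min (K x a) (M x₀ a) - K x₀ a|) μ :=
    (((hK x).inf (hM x₀)).sub (hK x₀)).abs
  have hi2 : Integrable (fun a => |M x a - M x₀ a|) μ := ((hM x).sub (hM x₀)).abs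
  rw [← integral_add hi1 hi2]
  refine integral_mono_ae (((hK x).sub (hK x₀)).abs) (hi1.add hi2) ?_
  filter_upwards [hle x] with a ha
  rcases le_total (K x a) (M x₀ a) with h | h
  · rw [min_eq_left h]
    have := abs_nonneg (M x a - M x₀ a)
    linarith
  · rw [min_eq_right h]
    have h1 := abs_add_le (M x₀ a - K x₀ a) (K x a - M x₀ a)
    have h2 : |K x a - M x₀ a| ≤ |M x a - M x₀ a| := by
      rw [abs_of_nonneg (by linarith)]
      exact le_trans (by linarith) (le_abs_self _)
    have h3 : M x₀ a - K x₀ a + (K x a - M x₀ a) = K x a - K x₀ a := by ring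
    rw [h3] at h1
    linarith

/-- An integral operator between spaces of continuous functions is compact as soon as its kernel
depends continuously in `L¹` on the parameter. -/
theorem exists_isCompactOperator_of_tendsto_integral_abs_sub {X Y Z : Type*} [TopologicalSpace X]
    [CompactSpace X] [TopologicalSpace Z] [CompactSpace Z] [MeasurableSpace Y]
    [MeasurableSpace Z] [BorelSpace Z] {ν : Measure Y} {ι : Y → Z} (hι : Measurable ι)
    {K : X → Y → ℝ} (hK : ∀ u, Integrable (K u) ν)
    (hc : ∀ u₀, Tendsto (fun u => ∫ s, |K u s - K u₀ s| ∂ν) (𝓝 u₀) (𝓝 0)) :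
    ∃ A : C(Z, ℝ) →L[ℝ] C(X, ℝ),
      (∀ x u, A x u = ∫ s, K u s * x (ι s) ∂ν) ∧ IsCompactOperator A := by
  have hint : ∀ u (x : C(Z, ℝ)), Integrable (fun s => K u s * x (ι s)) ν := by
    intro u x
    refine (hK u).mul_bdd (c := ‖x‖) ?_ ?_
    · exact (x.continuous.measurable.comp hι).aestronglyMeasurable
    · exact Eventually.of_forall fun s => x.norm_coe_le_norm _
  have hbd : ∀ u (x : C(Z, ℝ)), |∫ s, K u s * x (ι s) ∂ν| ≤ (∫ s, |K u s| ∂ν) * ‖x‖ := by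
    intro u x
    rw [← integral_mul_const]
    refine abs_integral_le_integral_abs.trans
      (integral_mono (hint u x).abs ((hK u).abs.mul_const _) fun s => ?_)
    simp only [abs_mul]
    exact mul_le_mul_of_nonneg_left (x.norm_coe_le_norm _) (abs_nonneg _)
  have hdiff : ∀ u₀ u (x : C(Z, ℝ)), |∫ s, K u s * x (ι s) ∂ν - ∫ s, K u₀ s * x (ι s) ∂ν|
      ≤ (∫ s, |K u s - K u₀ s| ∂ν) * ‖x‖ := by
    intro u₀ u x
    rw [← integral_sub (hint u x) (hint u₀ x), ← integral_mul_const]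
    refine abs_integral_le_integral_abs.trans
      (integral_mono ((hint u x).sub (hint u₀ x)).abs
        (((hK u).sub (hK u₀)).abs.mul_const _) fun s => ?_)
    simp only [← sub_mul, abs_mul]
    exact mul_le_mul_of_nonneg_left (x.norm_coe_le_norm _) (abs_nonneg _)
  have hcont : ∀ x : C(Z, ℝ), Continuous fun u => ∫ s, K u s * x (ι s) ∂ν := by
    intro x
    rw [continuous_iff_continuousAt]
    intro u₀
    refine tendsto_iff_norm_sub_tendsto_zero.2 (squeeze_zero (fun _ => norm_nonneg _)
      (fun u => hdiff u₀ u x) ?_)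
    simpa using (hc u₀).mul_const ‖x‖
  have hL1 : Continuous fun u => ∫ s, |K u s| ∂ν := by
    rw [continuous_iff_continuousAt]
    intro u₀
    refine tendsto_iff_norm_sub_tendsto_zero.2 (squeeze_zero (fun _ => norm_nonneg _)
      (fun u => ?_) (hc u₀))
    rw [← integral_sub (hK u).abs (hK u₀).abs]
    exact abs_integral_le_integral_abs.trans
      (integral_mono ((hK u).abs.sub (hK u₀).abs).abs ((hK u).sub (hK u₀)).abs
        fun s => abs_abs_sub_abs_le_abs_sub _ _)
  -- Compactness of X makes the L¹ norms uniformly bounded. If X is empty, C may be negative, hence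
  -- |C| below.
  obtain ⟨C, hC⟩ := isCompact_univ.exists_bound_of_continuousOn hL1.continuousOn
  have hC' : ∀ u, ∫ s, |K u s| ∂ν ≤ C := fun u => (le_abs_self _).trans (hC u (Set.mem_univ u))
  have hbd' : ∀ u (x : C(Z, ℝ)), |∫ s, K u s * x (ι s) ∂ν| ≤ |C| * ‖x‖ := fun u x =>
    (hbd u x).trans
      (mul_le_mul_of_nonneg_right ((hC' u).trans (le_abs_self C)) (norm_nonneg _))
  let A₀ : C(Z, ℝ) →ₗ[ℝ] C(X, ℝ) :=
    { toFun := fun x => ⟨fun u => ∫ s, K u s * x (ι s) ∂ν, hcont x⟩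
      map_add' := by
        intro x y
        ext u
        simp only [ContinuousMap.coe_mk, ContinuousMap.add_apply, mul_add]
        exact integral_add (hint u x) (hint u y)
      map_smul' := by
        intro c x
        ext u
        simp only [ContinuousMap.coe_mk, ContinuousMap.smul_apply, smul_eq_mul, RingHom.id_apply,
          mul_left_comm _ c]
        exact integral_const_mul c _ }
  let A : C(Z, ℝ) →L[ℝ] C(X, ℝ) := A₀.mkContinuous |C| fun x =>
    (ContinuousMap.norm_le _ (by positivity)).2 fun u => hbd' u x
  refine ⟨A, fun x u => rfl, ?_⟩
  let e := ContinuousMap.isometryEquivBoundedOfCompact X ℝ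
  have hcpt : IsCompact (closure (e '' (A '' Metric.closedBall 0 1))) := by
    refine BoundedContinuousFunction.arzela_ascoli (Metric.closedBall (0 : ℝ) |C|)
      (isCompact_closedBall _ _) _ ?_ ?_
    · rintro _ u ⟨_, ⟨x, hx, rfl⟩, rfl⟩
      rw [mem_closedBall_zero_iff] at hx ⊢
      exact (hbd' u x).trans (mul_le_of_le_one_right (abs_nonneg _) hx)
    · intro u₀
      rw [Metric.equicontinuousAt_iff_right]
      intro ε hε
      -- On the unit ball, `hdiff` bounds every increment by the same L¹ distance, which is
      -- equicontinuity.
      filter_upwards [(hc u₀).eventually_lt_const hε] with u hu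
      rintro ⟨_, _, ⟨x, hx, rfl⟩, rfl⟩
      rw [mem_closedBall_zero_iff] at hx
      rw [dist_comm]
      refine lt_of_le_of_lt ((hdiff u₀ u x).trans ?_) hu
      exact mul_le_of_le_one_right (integral_nonneg fun _ => abs_nonneg _) hx
  refine (isCompactOperator_iff_image_closedBall_subset_compact (A : C(Z, ℝ) →ₗ[ℝ] C(X, ℝ))
    one_pos).2 ⟨_, hcpt.image e.symm.continuous, ?_⟩
  intro y hy
  exact ⟨e y, subset_closure ⟨y, hy, rfl⟩, e.symm_apply_apply y⟩

/-! ### The derivative of K in scaled form -/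

noncomputable section

/-- The weight `(1-r)^(1/2-H₁) r^(H₂-3/2)` on the unit interval. -/
def fbmWeight (H₁ H₂ r : ℝ) : ℝ := (1 - r) ^ (1 / 2 - H₁) * r ^ (H₂ - 3 / 2)

/-- The average of `(v + (t-v) r)^(H₂-H₁)` against the weight. -/
def fbmAverage (H₁ H₂ t v : ℝ) : ℝ :=
  ∫ r in (0 : ℝ)..1, fbmWeight H₁ H₂ r * (v + (t - v) * r) ^ (H₂ - H₁)

/-- The average of `r (v + (t-v) r)^(H₂-H₁-1)` against the weight. -/
def fbmDerivAverage (H₁ H₂ t v : ℝ) : ℝ :=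
  ∫ r in (0 : ℝ)..1, fbmWeight H₁ H₂ r * (r * (v + (t - v) * r) ^ (H₂ - H₁ - 1))

/-- The profile `v ↦ ∂_t K(1, v)`, without the factor `β_{H₂} v^(1/2-H₂)`. -/
def fbmProfile (H₁ H₂ v : ℝ) : ℝ :=
  (H₂ - H₁) * (1 - v) ^ (H₂ - H₁ - 1) *
    (fbmAverage H₁ H₂ 1 v + (1 - v) * fbmDerivAverage H₁ H₂ 1 v)

/-- The total mass of the weight. -/
def fbmMass (H₁ H₂ : ℝ) : ℝ := ∫ r in (0 : ℝ)..1, fbmWeight H₁ H₂ r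

variable {H₁ H₂ : ℝ}

theorem measurable_fbmWeight : Measurable (fbmWeight H₁ H₂) := by
  unfold fbmWeight
  fun_prop

theorem fbmWeight_nonneg {r : ℝ} (h0 : 0 ≤ r) (h1 : r ≤ 1) : 0 ≤ fbmWeight H₁ H₂ r :=
  mul_nonneg (Real.rpow_nonneg (by linarith) _) (Real.rpow_nonneg h0 _)

theorem intervalIntegrable_fbmWeight (h₁ : H₁ < 3 / 2) (h₂ : 1 / 2 < H₂) :
    IntervalIntegrable (fbmWeight H₁ H₂) volume 0 1 :=
  intervalIntegrable_one_sub_rpow_mul_rpow (by linarith) (by linarith)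

theorem fbmMass_nonneg : 0 ≤ fbmMass H₁ H₂ :=
  intervalIntegral.integral_nonneg zero_le_one fun _ hr => fbmWeight_nonneg hr.1 hr.2

theorem intervalIntegrable_fbmWeight_mul (h₁ : H₁ < 3 / 2) (h₂ : 1 / 2 < H₂) {f : ℝ → ℝ}
    (hf : Measurable f) {C : ℝ} (hC : ∀ r, 0 < r → r ≤ 1 → |f r| ≤ C) :
    IntervalIntegrable (fun r => fbmWeight H₁ H₂ r * f r) volume 0 1 := by
  refine ((intervalIntegrable_fbmWeight h₁ h₂).mul_const C).mono_fun
    (measurable_fbmWeight.mul hf).aestronglyMeasurable ?_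
  rw [Set.uIoc_of_le zero_le_one]
  refine (ae_restrict_iff' measurableSet_Ioc).2 (Eventually.of_forall fun r hr => ?_)
  dsimp only
  rw [norm_mul, norm_mul]
  exact mul_le_mul_of_nonneg_left ((hC r hr.1 hr.2).trans (le_abs_self C)) (norm_nonneg _)

/-- Both t - w and w - v become multiples of t - v; their exponents add up to H₂ - H₁ - 1. -/
theorem fbmIntegrand_comp {t v r : ℝ} (hvt : v < t) (h0 : 0 ≤ r) (h1 : r ≤ 1) :
    fbmIntegrand H₁ H₂ t v (v + (t - v) * r) =
      (t - v) ^ (H₂ - H₁ - 1) * (fbmWeight H₁ H₂ r * (v + (t - v) * r) ^ (H₂ - H₁)) := by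
  have hp : 0 < t - v := by linarith
  unfold fbmIntegrand fbmWeight
  rw [show t - (v + (t - v) * r) = (t - v) * (1 - r) by ring,
    show v + (t - v) * r - v = (t - v) * r by ring,
    Real.mul_rpow hp.le (by linarith), Real.mul_rpow hp.le h0,
    show H₂ - H₁ - 1 = (1 / 2 - H₁) + (H₂ - 3 / 2) by ring, Real.rpow_add hp]
  ring

theorem convexComb_mem {t v r : ℝ} (hvt : v ≤ t) (h0 : 0 ≤ r) (h1 : r ≤ 1) :
    v ≤ v + (t - v) * r ∧ v + (t - v) * r ≤ t := by
  constructor <;> nlinarith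

theorem intervalIntegrable_fbmAverage (h₁ : H₁ < 3 / 2) (h₂ : 1 / 2 < H₂) (hH : H₁ < H₂)
    {t v : ℝ} (hv : 0 ≤ v) (hvt : v ≤ t) :
    IntervalIntegrable (fun r => fbmWeight H₁ H₂ r * (v + (t - v) * r) ^ (H₂ - H₁))
      volume 0 1 := by
  refine intervalIntegrable_fbmWeight_mul h₁ h₂ (by fun_prop) (C := t ^ (H₂ - H₁)) ?_
  intro r h0 h1
  obtain ⟨ha, hb⟩ := convexComb_mem hvt h0.le h1
  rw [abs_of_nonneg (Real.rpow_nonneg (hv.trans ha) _)]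
  exact Real.rpow_le_rpow (hv.trans ha) hb (by linarith)

theorem intervalIntegrable_fbmIntegrand (h₁ : H₁ < 3 / 2) (h₂ : 1 / 2 < H₂) (hH : H₁ < H₂)
    {t v : ℝ} (hv : 0 < v) (hvt : v < t) :
    IntervalIntegrable (fbmIntegrand H₁ H₂ t v) volume v t := by
  have h : IntervalIntegrable (fbmIntegrand H₁ H₂ t v) volume v (v + (t - v)) := by
    refine intervalIntegrable_of_comp_add_mul (by linarith) ?_
    refine (((intervalIntegrable_fbmAverage h₁ h₂ hH hv.le hvt.le).const_mul
      ((t - v) ^ (H₂ - H₁ - 1)))).congr ?_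
    intro r hr
    rw [Set.uIoc_of_le zero_le_one] at hr
    exact (fbmIntegrand_comp hvt hr.1.le hr.2).symm
  simpa using h

/-- The Jacobian t - v raises the exponent by one. Neither the limits of integration nor the
singular weight depends on t any more, so t can be differentiated under the integral. -/
theorem fbmKernel_eq {t v : ℝ} (hvt : v < t) :
    fbmKernel H₁ H₂ t v = betaConst H₂ * v ^ (1 / 2 - H₂) *
      ((t - v) ^ (H₂ - H₁) * fbmAverage H₁ H₂ t v) := by
  have hp : 0 < t - v := by linarith
  have h := integral_eq_mul_integral_comp_add_mul (fbmIntegrand H₁ H₂ t v) (t - v) v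
  rw [show v + (t - v) = t by ring] at h
  unfold fbmKernel
  rw [h]
  congr 1
  have h2 : ∫ r in (0 : ℝ)..1, fbmIntegrand H₁ H₂ t v (v + (t - v) * r) =
      ∫ r in (0 : ℝ)..1, (t - v) ^ (H₂ - H₁ - 1) *
        (fbmWeight H₁ H₂ r * (v + (t - v) * r) ^ (H₂ - H₁)) := by
    refine intervalIntegral.integral_congr fun r hr => ?_
    rw [Set.uIcc_of_le zero_le_one] at hr
    exact fbmIntegrand_comp hvt hr.1 hr.2
  rw [h2, intervalIntegral.integral_const_mul, ← mul_assoc, Real.rpow_sub_one hp.ne',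
    mul_div_cancel₀ _ hp.ne', fbmAverage]

/-- For every τ > v the base v + (τ-v)r is at least v, and H₂ - H₁ - 1 ≤ 0, so a power of v
dominates the differentiated factor on the whole half-line. -/
theorem hasDerivAt_fbmAverage (h₁ : H₁ < 3 / 2) (h₂ : 1 / 2 < H₂) (hH : H₁ < H₂)
    (hH' : H₂ - H₁ ≤ 1) {t v : ℝ} (hv : 0 < v) (hvt : v < t) :
    HasDerivAt (fun τ => fbmAverage H₁ H₂ τ v)
      ((H₂ - H₁) * fbmDerivAverage H₁ H₂ t v) t := by
  have h := (intervalIntegral.hasDerivAt_integral_of_dominated_loc_of_deriv_le (μ := volume)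
    (a := 0) (b := 1) (x₀ := t) (s := Set.Ioi v)
    (F := fun τ r => fbmWeight H₁ H₂ r * (v + (τ - v) * r) ^ (H₂ - H₁))
    (F' := fun τ r =>
      (H₂ - H₁) * (fbmWeight H₁ H₂ r * (r * (v + (τ - v) * r) ^ (H₂ - H₁ - 1))))
    (bound := fun r => fbmWeight H₁ H₂ r * ((H₂ - H₁) * v ^ (H₂ - H₁ - 1)))
    (Ioi_mem_nhds hvt) ?_ (intervalIntegrable_fbmAverage h₁ h₂ hH hv.le hvt.le) ?_ ?_
    ((intervalIntegrable_fbmWeight h₁ h₂).mul_const _) ?_).2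
  · rwa [intervalIntegral.integral_const_mul] at h
  · refine Eventually.of_forall fun τ => ?_
    have := measurable_fbmWeight (H₁ := H₁) (H₂ := H₂)
    exact Measurable.aestronglyMeasurable (by fun_prop)
  · have := measurable_fbmWeight (H₁ := H₁) (H₂ := H₂)
    exact Measurable.aestronglyMeasurable (by fun_prop)
  · refine Eventually.of_forall fun r hr τ hτ => ?_
    rw [Set.uIoc_of_le zero_le_one] at hr
    have hτ' : v < τ := hτ
    obtain ⟨ha, hb⟩ := convexComb_mem hτ'.le hr.1.le hr.2
    have hw := fbmWeight_nonneg (H₁ := H₁) (H₂ := H₂) hr.1.le hr.2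
    have hx : 0 ≤ (v + (τ - v) * r) ^ (H₂ - H₁ - 1) := Real.rpow_nonneg (by linarith) _
    have hy : (v + (τ - v) * r) ^ (H₂ - H₁ - 1) ≤ v ^ (H₂ - H₁ - 1) :=
      Real.rpow_le_rpow_of_nonpos hv ha (by linarith)
    have hγ : 0 ≤ H₂ - H₁ := by linarith
    rw [Real.norm_of_nonneg (mul_nonneg hγ (mul_nonneg hw (mul_nonneg hr.1.le hx))),
      mul_left_comm]
    refine mul_le_mul_of_nonneg_left (mul_le_mul_of_nonneg_left ?_ hγ) hw
    exact (mul_le_of_le_one_left hx hr.2).trans hy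
  · refine Eventually.of_forall fun r hr τ hτ => ?_
    rw [Set.uIoc_of_le zero_le_one] at hr
    have hτ' : v < τ := hτ
    obtain ⟨ha, hb⟩ := convexComb_mem hτ'.le hr.1.le hr.2
    have hlin : HasDerivAt (fun τ : ℝ => v + (τ - v) * r) r τ := by
      simpa using (((hasDerivAt_id τ).sub_const v).mul_const r).const_add v
    have h := (hlin.rpow_const (p := H₂ - H₁)
      (Or.inl (by linarith : v + (τ - v) * r ≠ 0))).const_mul (fbmWeight H₁ H₂ r)
    refine h.congr_deriv ?_
    ring

theorem convexComb_rpow_div {t v r p : ℝ} (hv : 0 ≤ v) (hvt : v ≤ t) (ht : 0 < t) (h0 : 0 ≤ r)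
    (h1 : r ≤ 1) : (v + (t - v) * r) ^ p = t ^ p * (v / t + (1 - v / t) * r) ^ p := by
  have h : v / t ≤ 1 := (div_le_one ht).2 hvt
  rw [← Real.mul_rpow ht.le ((div_nonneg hv ht.le).trans (convexComb_mem h h0 h1).1)]
  congr 1
  field_simp

theorem fbmAverage_eq {t v : ℝ} (hv : 0 ≤ v) (hvt : v ≤ t) (ht : 0 < t) :
    fbmAverage H₁ H₂ t v = t ^ (H₂ - H₁) * fbmAverage H₁ H₂ 1 (v / t) := by
  unfold fbmAverage
  rw [← intervalIntegral.integral_const_mul]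
  refine intervalIntegral.integral_congr fun r hr => ?_
  rw [Set.uIcc_of_le zero_le_one] at hr
  rw [convexComb_rpow_div hv hvt ht hr.1 hr.2]
  ring

theorem fbmDerivAverage_eq {t v : ℝ} (hv : 0 ≤ v) (hvt : v ≤ t) (ht : 0 < t) :
    fbmDerivAverage H₁ H₂ t v = t ^ (H₂ - H₁ - 1) * fbmDerivAverage H₁ H₂ 1 (v / t) := by
  unfold fbmDerivAverage
  rw [← intervalIntegral.integral_const_mul]
  refine intervalIntegral.integral_congr fun r hr => ?_
  rw [Set.uIcc_of_le zero_le_one] at hr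
  rw [convexComb_rpow_div hv hvt ht hr.1 hr.2]
  ring

theorem hasDerivAt_fbmKernel (h₁ : H₁ < 3 / 2) (h₂ : 1 / 2 < H₂) (hH : H₁ < H₂)
    (hH' : H₂ - H₁ ≤ 1) {t v : ℝ} (hv : 0 < v) (hvt : v < t) :
    HasDerivAt (fun τ => fbmKernel H₁ H₂ τ v) (betaConst H₂ * v ^ (1 / 2 - H₂) *
      (t ^ (2 * (H₂ - H₁) - 1) * fbmProfile H₁ H₂ (v / t))) t := by
  have ht : 0 < t := hv.trans hvt
  have hp : 0 < t - v := by linarith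
  have hq : 0 ≤ 1 - v / t := by linarith [(div_le_one ht).2 hvt.le]
  have h1 : HasDerivAt (fun τ => (τ - v) ^ (H₂ - H₁))
      ((H₂ - H₁) * (t - v) ^ (H₂ - H₁ - 1)) t := by
    simpa using ((hasDerivAt_id t).sub_const v).rpow_const (p := H₂ - H₁) (Or.inl hp.ne')
  have h2 := (h1.mul (hasDerivAt_fbmAverage h₁ h₂ hH hH' hv hvt)).const_mul
    (betaConst H₂ * v ^ (1 / 2 - H₂))
  have h3 : HasDerivAt (fun τ => fbmKernel H₁ H₂ τ v) _ t :=
    h2.congr_of_eventuallyEq (by filter_upwards [Ioi_mem_nhds hvt] with τ hτ using fbmKernel_eq hτ)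
  convert h3 using 1
  congr 1
  -- With one power split off, both terms of the product rule share the factor (t-v)^(H₂-H₁-1) found
  -- in `fbmProfile`; homogeneity then extracts the powers of t.
  have hpow : (t - v) ^ (H₂ - H₁) = (t - v) ^ (H₂ - H₁ - 1) * (t - v) := by
    rw [Real.rpow_sub_one hp.ne', div_mul_cancel₀ _ hp.ne']
  rw [hpow, fbmAverage_eq hv.le hvt.le ht, fbmDerivAverage_eq hv.le hvt.le ht, fbmProfile,
    show t - v = t * (1 - v / t) by field_simp, Real.mul_rpow ht.le hq,
    show 2 * (H₂ - H₁) - 1 = (H₂ - H₁ - 1) + (H₂ - H₁) by ring, Real.rpow_add ht,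
    show t ^ (H₂ - H₁) = t ^ (H₂ - H₁ - 1) * t by
      rw [Real.rpow_sub_one ht.ne', div_mul_cancel₀ _ ht.ne']]
  ring

theorem fbmKernelDeriv_eq (h₁ : H₁ < 3 / 2) (h₂ : 1 / 2 < H₂) (hH : H₁ < H₂)
    (hH' : H₂ - H₁ ≤ 1) {t v : ℝ} (hv : 0 < v) (hvt : v < t) :
    fbmKernelDeriv H₁ H₂ t v = betaConst H₂ * v ^ (1 / 2 - H₂) *
      (t ^ (2 * (H₂ - H₁) - 1) * fbmProfile H₁ H₂ (v / t)) :=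
  (hasDerivAt_fbmKernel h₁ h₂ hH hH' hv hvt).deriv

theorem rpow_convexComb_le_one {v r p : ℝ} (hv : 0 ≤ v) (hv1 : v ≤ 1) (h0 : 0 ≤ r) (h1 : r ≤ 1)
    (hp : 0 ≤ p) : (v + (1 - v) * r) ^ p ≤ 1 :=
  Real.rpow_le_one (hv.trans (convexComb_mem hv1 h0 h1).1) (convexComb_mem hv1 h0 h1).2 hp

/-- The base is r + v(1-r) ≥ r, so the factor r absorbs the negative power. Unlike a bound by v^p,
this one is uniform down to v = 0. -/
theorem mul_rpow_convexComb_le_one {v r p : ℝ} (hv : 0 ≤ v) (h0 : 0 < r)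
    (h1 : r ≤ 1) (hp : -1 ≤ p) (hp' : p ≤ 0) : r * (v + (1 - v) * r) ^ p ≤ 1 := by
  have h : (v + (1 - v) * r) ^ p ≤ r ^ p :=
    Real.rpow_le_rpow_of_nonpos h0 (by nlinarith) hp'
  calc r * (v + (1 - v) * r) ^ p ≤ r * r ^ p := mul_le_mul_of_nonneg_left h h0.le
    _ = r ^ (p + 1) := by rw [Real.rpow_add_one h0.ne', mul_comm]
    _ ≤ 1 := Real.rpow_le_one h0.le h1 (by linarith)

theorem continuousOn_integral_fbmWeight_mul (h₁ : H₁ < 3 / 2) (h₂ : 1 / 2 < H₂)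
    {f : ℝ → ℝ → ℝ} {S : Set ℝ} (hf : ∀ v, Measurable (f v))
    (h0 : ∀ v ∈ S, ∀ r, 0 < r → r ≤ 1 → 0 ≤ f v r)
    (h1 : ∀ v ∈ S, ∀ r, 0 < r → r ≤ 1 → f v r ≤ 1)
    (hc : ∀ r, 0 < r → r ≤ 1 → ContinuousOn (fun v => f v r) S) :
    ContinuousOn (fun v => ∫ r in (0 : ℝ)..1, fbmWeight H₁ H₂ r * f v r) S := by
  intro v₀ hv₀
  refine intervalIntegral.continuousWithinAt_of_dominated_interval (bound := fbmWeight H₁ H₂)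
    ?_ ?_ (intervalIntegrable_fbmWeight h₁ h₂) ?_
  · exact Eventually.of_forall fun v => (measurable_fbmWeight.mul (hf v)).aestronglyMeasurable
  · filter_upwards [self_mem_nhdsWithin] with v hv
    refine Eventually.of_forall fun r hr => ?_
    rw [Set.uIoc_of_le zero_le_one] at hr
    have hw := fbmWeight_nonneg (H₁ := H₁) (H₂ := H₂) hr.1.le hr.2
    rw [Real.norm_of_nonneg (mul_nonneg hw (h0 v hv r hr.1 hr.2))]
    exact mul_le_of_le_one_right hw (h1 v hv r hr.1 hr.2)
  · refine Eventually.of_forall fun r hr => ?_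
    rw [Set.uIoc_of_le zero_le_one] at hr
    exact continuousWithinAt_const.mul (hc r hr.1 hr.2 v₀ hv₀)

theorem integral_fbmWeight_mul_mem (h₁ : H₁ < 3 / 2) (h₂ : 1 / 2 < H₂) {f : ℝ → ℝ}
    (hf : Measurable f) (h0 : ∀ r, 0 < r → r ≤ 1 → 0 ≤ f r)
    (h1 : ∀ r, 0 < r → r ≤ 1 → f r ≤ 1) :
    0 ≤ ∫ r in (0 : ℝ)..1, fbmWeight H₁ H₂ r * f r ∧
      ∫ r in (0 : ℝ)..1, fbmWeight H₁ H₂ r * f r ≤ fbmMass H₁ H₂ := by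
  have hw : ∀ r, 0 < r → r ≤ 1 → 0 ≤ fbmWeight H₁ H₂ r := fun r hr hr' =>
    fbmWeight_nonneg hr.le hr'
  constructor
  · rw [intervalIntegral.integral_of_le zero_le_one]
    exact setIntegral_nonneg measurableSet_Ioc fun r hr =>
      mul_nonneg (hw r hr.1 hr.2) (h0 r hr.1 hr.2)
  · refine intervalIntegral.integral_mono_on_of_le_Ioo zero_le_one
      (intervalIntegrable_fbmWeight_mul h₁ h₂ hf (C := 1) fun r hr hr' => ?_)
      (intervalIntegrable_fbmWeight h₁ h₂) fun r hr =>
        mul_le_of_le_one_right (hw r hr.1 hr.2.le) (h1 r hr.1 hr.2.le)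
    rw [abs_of_nonneg (h0 r hr hr')]
    exact h1 r hr hr'

theorem fbmProfile_nonneg_le (h₁ : H₁ < 3 / 2) (h₂ : 1 / 2 < H₂) (hH : H₁ < H₂)
    (hH' : H₂ - H₁ ≤ 1) {v : ℝ} (hv : 0 ≤ v) (hv1 : v ≤ 1) :
    0 ≤ fbmProfile H₁ H₂ v ∧
      fbmProfile H₁ H₂ v ≤ 2 * (H₂ - H₁) * fbmMass H₁ H₂ * (1 - v) ^ (H₂ - H₁ - 1) := by
  obtain ⟨ha, hb⟩ := integral_fbmWeight_mul_mem h₁ h₂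
    (f := fun r => (v + (1 - v) * r) ^ (H₂ - H₁)) (by fun_prop)
    (fun r h0 h1 => Real.rpow_nonneg (hv.trans (convexComb_mem hv1 h0.le h1).1) _)
    (fun r h0 h1 => rpow_convexComb_le_one hv hv1 h0.le h1 (by linarith))
  obtain ⟨hc, hd⟩ := integral_fbmWeight_mul_mem h₁ h₂
    (f := fun r => r * (v + (1 - v) * r) ^ (H₂ - H₁ - 1)) (by fun_prop)
    (fun r h0 h1 => mul_nonneg h0.le
      (Real.rpow_nonneg (hv.trans (convexComb_mem hv1 h0.le h1).1) _))
    (fun r h0 h1 => mul_rpow_convexComb_le_one hv h0 h1 (by linarith) (by linarith))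
  change 0 ≤ fbmAverage H₁ H₂ 1 v at ha
  change fbmAverage H₁ H₂ 1 v ≤ _ at hb
  change 0 ≤ fbmDerivAverage H₁ H₂ 1 v at hc
  change fbmDerivAverage H₁ H₂ 1 v ≤ _ at hd
  have hγ : 0 ≤ (H₂ - H₁) * (1 - v) ^ (H₂ - H₁ - 1) :=
    mul_nonneg (by linarith) (Real.rpow_nonneg (by linarith) _)
  unfold fbmProfile
  constructor
  · exact mul_nonneg hγ (add_nonneg ha (mul_nonneg (by linarith) hc))
  · have : fbmAverage H₁ H₂ 1 v + (1 - v) * fbmDerivAverage H₁ H₂ 1 v ≤ 2 * fbmMass H₁ H₂ := by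
      have := mul_le_of_le_one_left hc (by linarith : 1 - v ≤ 1)
      linarith
    calc _ ≤ (H₂ - H₁) * (1 - v) ^ (H₂ - H₁ - 1) * (2 * fbmMass H₁ H₂) :=
          mul_le_mul_of_nonneg_left this hγ
      _ = _ := by ring

/-- The point 0 is included because κ(s,0) needs it: for r > 0 the base v + (1-v)r stays positive
even at v = 0. -/
theorem continuousOn_fbmProfile (h₁ : H₁ < 3 / 2) (h₂ : 1 / 2 < H₂) (hH : H₁ < H₂)
    (hH' : H₂ - H₁ ≤ 1) : ContinuousOn (fbmProfile H₁ H₂) (Set.Ico 0 1) := by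
  have hpos : ∀ {v r : ℝ}, v ∈ Set.Ico (0 : ℝ) 1 → 0 < r → 0 < v + (1 - v) * r := by
    intro v r hv hr
    have := mul_pos (by linarith [hv.2] : 0 < 1 - v) hr
    linarith [hv.1]
  have hA : ContinuousOn (fbmAverage H₁ H₂ 1) (Set.Ico 0 1) :=
    continuousOn_integral_fbmWeight_mul h₁ h₂
      (f := fun v r => (v + (1 - v) * r) ^ (H₂ - H₁)) (fun v => by fun_prop)
      (fun v hv r h0 h1 => Real.rpow_nonneg (hpos hv h0).le _)
      (fun v hv r h0 h1 => rpow_convexComb_le_one hv.1 hv.2.le h0.le h1 (by linarith))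
      (fun r h0 h1 => ContinuousOn.rpow_const (by fun_prop) fun v hv => Or.inl (hpos hv h0).ne')
  have hB : ContinuousOn (fbmDerivAverage H₁ H₂ 1) (Set.Ico 0 1) :=
    continuousOn_integral_fbmWeight_mul h₁ h₂
      (f := fun v r => r * (v + (1 - v) * r) ^ (H₂ - H₁ - 1)) (fun v => by fun_prop)
      (fun v hv r h0 h1 => mul_nonneg h0.le (Real.rpow_nonneg (hpos hv h0).le _))
      (fun v hv r h0 h1 =>
        mul_rpow_convexComb_le_one hv.1 h0 h1 (by linarith) (by linarith))
      (fun r h0 h1 => continuousOn_const.mul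
        (ContinuousOn.rpow_const (by fun_prop) fun v hv => Or.inl (hpos hv h0).ne'))
  have hC : ContinuousOn (fun v : ℝ => (1 - v) ^ (H₂ - H₁ - 1)) (Set.Ico 0 1) :=
    ContinuousOn.rpow_const (by fun_prop) fun v hv => Or.inl (by linarith [hv.2])
  have hD : ContinuousOn (fun v : ℝ => 1 - v) (Set.Ico 0 1) := by fun_prop
  exact (continuousOn_const.mul hC).mul (hA.add (hD.mul hB))

theorem measurable_integral_fbmWeight_mul {f : ℝ → ℝ → ℝ}
    (hf : Measurable (Function.uncurry f)) :
    Measurable fun v => ∫ r in (0 : ℝ)..1, fbmWeight H₁ H₂ r * f v r := by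
  simp_rw [intervalIntegral.integral_of_le zero_le_one]
  refine StronglyMeasurable.measurable (StronglyMeasurable.integral_prod_right'
    (f := fun p : ℝ × ℝ => fbmWeight H₁ H₂ p.2 * f p.1 p.2) (Measurable.stronglyMeasurable ?_))
  exact (measurable_fbmWeight.comp measurable_snd).mul hf

theorem measurable_fbmProfile : Measurable (fbmProfile H₁ H₂) := by
  have hA : Measurable (fbmAverage H₁ H₂ 1) :=
    measurable_integral_fbmWeight_mul (f := fun v r => (v + (1 - v) * r) ^ (H₂ - H₁))
      (by unfold Function.uncurry; fun_prop)
  have hB : Measurable (fbmDerivAverage H₁ H₂ 1) :=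
    measurable_integral_fbmWeight_mul (f := fun v r => r * (v + (1 - v) * r) ^ (H₂ - H₁ - 1))
      (by unfold Function.uncurry; fun_prop)
  unfold fbmProfile
  fun_prop

end

/-! ### Scaling form of k and κ -/

noncomputable section

/-- The integrand of `kappaProfile`. -/
def kappaProfileIntegrand (H₁ H₂ r x : ℝ) : ℝ :=
  x ^ (1 - 2 * H₂) * (fbmProfile H₁ H₂ (r * x) * fbmProfile H₁ H₂ x)

/-- The function `g` on `[0, 1)` with `κ(s, u) = s^(2(H₂-H₁)-1) g(u/s)` for `u < s`. -/
def kappaProfile (H₁ H₂ r : ℝ) : ℝ :=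
  betaConst H₂ ^ 2 * ∫ x in (0 : ℝ)..1, kappaProfileIntegrand H₁ H₂ r x

variable {H₁ H₂ : ℝ}

theorem measurable_kappaProfileIntegrand :
    Measurable (Function.uncurry (kappaProfileIntegrand H₁ H₂)) := by
  have := measurable_fbmProfile (H₁ := H₁) (H₂ := H₂)
  unfold Function.uncurry kappaProfileIntegrand
  fun_prop

theorem measurable_kappaProfile : Measurable (kappaProfile H₁ H₂) := by
  unfold kappaProfile
  simp_rw [intervalIntegral.integral_of_le zero_le_one]
  refine Measurable.const_mul (StronglyMeasurable.measurable
    (StronglyMeasurable.integral_prod_right ?_)) _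
  exact measurable_kappaProfileIntegrand.stronglyMeasurable

/-- The inequality 1 - rx ≥ 1 - r separates r from x. What remains in x is a beta integrand,
integrable because H₂ - H₁ > 0 and H₂ < 1. -/
theorem exists_kappaProfileIntegrand_le (hH₁ : 1 / 2 ≤ H₁) (hH : H₁ < H₂) (hH₂ : H₂ < 1) :
    ∃ C, 0 ≤ C ∧ ∀ r x, 0 ≤ r → r < 1 → 0 < x → x ≤ 1 →
      0 ≤ kappaProfileIntegrand H₁ H₂ r x ∧ kappaProfileIntegrand H₁ H₂ r x ≤
        C * (1 - r) ^ (H₂ - H₁ - 1) * ((1 - x) ^ (H₂ - H₁ - 1) * x ^ (1 - 2 * H₂)) := by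
  have hD : 0 ≤ 2 * (H₂ - H₁) * fbmMass H₁ H₂ :=
    mul_nonneg (by linarith) fbmMass_nonneg
  refine ⟨(2 * (H₂ - H₁) * fbmMass H₁ H₂) ^ 2, sq_nonneg _, fun r x hr hr1 hx hx1 => ?_⟩
  have hrx : r * x ≤ r := mul_le_of_le_one_right hr hx1
  obtain ⟨h1, h2⟩ := fbmProfile_nonneg_le (H₁ := H₁) (H₂ := H₂) (by linarith) (by linarith) hH
    (by linarith) hx.le hx1
  obtain ⟨h3, h4⟩ := fbmProfile_nonneg_le (H₁ := H₁) (H₂ := H₂) (by linarith) (by linarith) hH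
    (by linarith) (mul_nonneg hr hx.le) (hrx.trans hr1.le)
  have h5 : (1 - r * x) ^ (H₂ - H₁ - 1) ≤ (1 - r) ^ (H₂ - H₁ - 1) :=
    Real.rpow_le_rpow_of_nonpos (by linarith) (by linarith) (by linarith)
  have h6 := h4.trans (mul_le_mul_of_nonneg_left h5 hD)
  have h7 : 0 ≤ x ^ (1 - 2 * H₂) := Real.rpow_nonneg hx.le _
  unfold kappaProfileIntegrand
  refine ⟨mul_nonneg h7 (mul_nonneg h3 h1), ?_⟩
  calc _ ≤ x ^ (1 - 2 * H₂) * ((2 * (H₂ - H₁) * fbmMass H₁ H₂ * (1 - r) ^ (H₂ - H₁ - 1)) *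
        (2 * (H₂ - H₁) * fbmMass H₁ H₂ * (1 - x) ^ (H₂ - H₁ - 1))) :=
        mul_le_mul_of_nonneg_left (mul_le_mul h6 h2 h1 (h3.trans h6)) h7
    _ = _ := by ring

theorem intervalIntegrable_kappaProfileIntegrand (hH₁ : 1 / 2 ≤ H₁) (hH : H₁ < H₂) (hH₂ : H₂ < 1)
    {r : ℝ} (hr : 0 ≤ r) (hr1 : r < 1) :
    IntervalIntegrable (kappaProfileIntegrand H₁ H₂ r) volume 0 1 := by
  obtain ⟨C, hC, hb⟩ := exists_kappaProfileIntegrand_le hH₁ hH hH₂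
  refine ((intervalIntegrable_one_sub_rpow_mul_rpow (p := H₂ - H₁ - 1) (q := 1 - 2 * H₂)
    (by linarith) (by linarith)).const_mul (C * (1 - r) ^ (H₂ - H₁ - 1))).mono_fun
    (measurable_kappaProfileIntegrand.of_uncurry_left).aestronglyMeasurable ?_
  rw [Set.uIoc_of_le zero_le_one]
  refine (ae_restrict_iff' measurableSet_Ioc).2 (Eventually.of_forall fun x hx => ?_)
  obtain ⟨h1, h2⟩ := hb r x hr hr1 hx.1 hx.2
  dsimp only
  rw [Real.norm_of_nonneg h1]
  exact h2.trans (le_abs_self _)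

theorem exists_kappaProfile_le (hH₁ : 1 / 2 ≤ H₁) (hH : H₁ < H₂) (hH₂ : H₂ < 1) :
    ∃ C, 0 ≤ C ∧ ∀ r, 0 ≤ r → r < 1 →
      0 ≤ kappaProfile H₁ H₂ r ∧ kappaProfile H₁ H₂ r ≤ C * (1 - r) ^ (H₂ - H₁ - 1) := by
  obtain ⟨C, hC, hb⟩ := exists_kappaProfileIntegrand_le hH₁ hH hH₂
  have hI : 0 ≤ ∫ x in (0 : ℝ)..1, (1 - x) ^ (H₂ - H₁ - 1) * x ^ (1 - 2 * H₂) :=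
    intervalIntegral.integral_nonneg zero_le_one fun x hx =>
      mul_nonneg (Real.rpow_nonneg (by linarith [hx.2]) _) (Real.rpow_nonneg hx.1 _)
  refine ⟨betaConst H₂ ^ 2 *
    (C * ∫ x in (0 : ℝ)..1, (1 - x) ^ (H₂ - H₁ - 1) * x ^ (1 - 2 * H₂)), by positivity,
    fun r hr hr1 => ⟨mul_nonneg (sq_nonneg _) ?_, ?_⟩⟩
  · rw [intervalIntegral.integral_of_le zero_le_one]
    exact setIntegral_nonneg measurableSet_Ioc fun x hx => (hb r x hr hr1 hx.1 hx.2).1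
  · rw [mul_assoc]
    refine mul_le_mul_of_nonneg_left ?_ (sq_nonneg _)
    rw [mul_right_comm, ← intervalIntegral.integral_const_mul]
    exact intervalIntegral.integral_mono_on_of_le_Ioo zero_le_one
      (intervalIntegrable_kappaProfileIntegrand hH₁ hH hH₂ hr hr1)
      ((intervalIntegrable_one_sub_rpow_mul_rpow (by linarith) (by linarith)).const_mul _)
      fun x hx => (hb r x hr hr1 hx.1 hx.2.le).2

theorem continuousOn_kappaProfile (hH₁ : 1 / 2 ≤ H₁) (hH : H₁ < H₂) (hH₂ : H₂ < 1) :
    ContinuousOn (kappaProfile H₁ H₂) (Set.Ico 0 1) := by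
  obtain ⟨C, hC, hb⟩ := exists_kappaProfileIntegrand_le hH₁ hH hH₂
  intro r₀ hr₀
  refine continuousWithinAt_const.mul ?_
  -- The bound degenerates as r → 1; staying below r₁ < 1 makes it uniform near r₀.
  obtain ⟨r₁, hr₁, hr₁'⟩ := exists_between hr₀.2
  refine intervalIntegral.continuousWithinAt_of_dominated_interval
    (bound := fun x => C * (1 - r₁) ^ (H₂ - H₁ - 1) *
      ((1 - x) ^ (H₂ - H₁ - 1) * x ^ (1 - 2 * H₂))) ?_ ?_
    ((intervalIntegrable_one_sub_rpow_mul_rpow (by linarith) (by linarith)).const_mul _) ?_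
  · exact Eventually.of_forall fun r =>
      (measurable_kappaProfileIntegrand.of_uncurry_left).aestronglyMeasurable
  · filter_upwards [self_mem_nhdsWithin, mem_nhdsWithin_of_mem_nhds (Iio_mem_nhds hr₁)]
      with r hr hr'
    refine Eventually.of_forall fun x hx => ?_
    rw [Set.uIoc_of_le zero_le_one] at hx
    have hr'' : r < r₁ := hr'
    obtain ⟨h1, h2⟩ := hb r x hr.1 hr.2 hx.1 hx.2
    rw [Real.norm_of_nonneg h1]
    refine h2.trans (mul_le_mul_of_nonneg_right (mul_le_mul_of_nonneg_left ?_ hC) ?_)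
    · exact Real.rpow_le_rpow_of_nonpos (by linarith) (by linarith) (by linarith)
    · exact mul_nonneg (Real.rpow_nonneg (by linarith [hx.2]) _) (Real.rpow_nonneg hx.1.le _)
  · refine Eventually.of_forall fun x hx => ?_
    rw [Set.uIoc_of_le zero_le_one] at hx
    have hmaps : Set.MapsTo (fun r : ℝ => r * x) (Set.Ico 0 1) (Set.Ico 0 1) := fun r hr =>
      ⟨mul_nonneg hr.1 hx.1.le, (mul_le_of_le_one_right hr.1 hx.2).trans_lt hr.2⟩
    have h := (continuousOn_fbmProfile (H₁ := H₁) (H₂ := H₂) (by linarith) (by linarith) hH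
      (by linarith)).comp (by fun_prop : ContinuousOn (fun r : ℝ => r * x) (Set.Ico 0 1)) hmaps
    exact continuousWithinAt_const.mul ((h r₀ hr₀).mul continuousWithinAt_const)

/-- The exponent of u is 2(1/2-H₂) + 2(H₂-H₁) - 1 = -2H₁. The derivative formula needs ux < u, so x
= 1 is excluded. -/
theorem fbmKernelDeriv_mul_comp (hH₁ : 1 / 2 ≤ H₁) (hH : H₁ < H₂) (hH₂ : H₂ < 1) {s u x : ℝ}
    (hu : 0 < u) (hus : u < s) (hx : 0 < x) (hx1 : x < 1) :
    fbmKernelDeriv H₁ H₂ s (u * x) * fbmKernelDeriv H₁ H₂ u (u * x) =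
      betaConst H₂ ^ 2 * (u ^ (-(2 * H₁)) * s ^ (2 * (H₂ - H₁) - 1)) *
        kappaProfileIntegrand H₁ H₂ (u / s) x := by
  have hux : u * x < u := mul_lt_of_lt_one_right hu hx1
  have hux0 : 0 < u * x := mul_pos hu hx
  rw [fbmKernelDeriv_eq (by linarith) (by linarith) hH (by linarith) hux0 (hux.trans hus),
    fbmKernelDeriv_eq (by linarith) (by linarith) hH (by linarith) hux0 hux,
    mul_div_right_comm, mul_div_cancel_left₀ _ hu.ne', kappaProfileIntegrand,
    Real.mul_rpow hu.le hx.le,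
    show -(2 * H₁) = (1 / 2 - H₂) + (1 / 2 - H₂) + (2 * (H₂ - H₁) - 1) by ring,
    Real.rpow_add hu, Real.rpow_add hu,
    show 1 - 2 * H₂ = (1 / 2 - H₂) + (1 / 2 - H₂) by ring, Real.rpow_add hx]
  ring

theorem ae_ne_volume (a : ℝ) : ∀ᵐ x : ℝ, x ≠ a :=
  (measure_eq_zero_iff_ae_notMem).1 (measure_singleton a)

theorem ae_fbmKernelDeriv_mul_comp (hH₁ : 1 / 2 ≤ H₁) (hH : H₁ < H₂) (hH₂ : H₂ < 1) {s u : ℝ}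
    (hu : 0 < u) (hus : u < s) : ∀ᵐ x : ℝ, x ∈ Set.uIoc 0 1 →
    fbmKernelDeriv H₁ H₂ s (u * x) * fbmKernelDeriv H₁ H₂ u (u * x) =
      betaConst H₂ ^ 2 * (u ^ (-(2 * H₁)) * s ^ (2 * (H₂ - H₁) - 1)) *
        kappaProfileIntegrand H₁ H₂ (u / s) x := by
  filter_upwards [ae_ne_volume 1] with x hx1 hx
  rw [Set.uIoc_of_le zero_le_one] at hx
  exact fbmKernelDeriv_mul_comp hH₁ hH hH₂ hu hus hx.1 (lt_of_le_of_ne hx.2 hx1)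

theorem intervalIntegrable_fbmKernelDeriv_mul (hH₁ : 1 / 2 ≤ H₁) (hH : H₁ < H₂) (hH₂ : H₂ < 1)
    {s u : ℝ} (hu : 0 < u) (hus : u < s) :
    IntervalIntegrable (fun v => fbmKernelDeriv H₁ H₂ s v * fbmKernelDeriv H₁ H₂ u v)
      volume 0 u := by
  have h : IntervalIntegrable (fun v => fbmKernelDeriv H₁ H₂ s v * fbmKernelDeriv H₁ H₂ u v)
      volume 0 (0 + u) := by
    refine intervalIntegrable_of_comp_add_mul hu.ne' ?_
    simp only [zero_add]
    refine ((intervalIntegrable_kappaProfileIntegrand hH₁ hH hH₂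
      (div_nonneg hu.le (hu.trans hus).le) ((div_lt_one (hu.trans hus)).2 hus)).const_mul
      (betaConst H₂ ^ 2 * (u ^ (-(2 * H₁)) * s ^ (2 * (H₂ - H₁) - 1)))).congr_ae ?_
    refine (ae_restrict_iff' measurableSet_uIoc).2 ?_
    filter_upwards [ae_fbmKernelDeriv_mul_comp hH₁ hH hH₂ hu hus] with x hx hx'
    exact (hx hx').symm
  simpa using h

theorem kKernel_symm (s u : ℝ) : kKernel H₁ H₂ s u = kKernel H₁ H₂ u s := by
  unfold kKernel
  rw [min_comm]
  simp_rw [mul_comm]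

theorem kKernel_eq (hH₁ : 1 / 2 ≤ H₁) (hH : H₁ < H₂) (hH₂ : H₂ < 1) {s u : ℝ} (hu : 0 < u)
    (hus : u < s) : kKernel H₁ H₂ s u =
      u ^ (1 - 2 * H₁) * (s ^ (2 * (H₂ - H₁) - 1) * kappaProfile H₁ H₂ (u / s)) := by
  have h := integral_eq_mul_integral_comp_add_mul
    (fun v => fbmKernelDeriv H₁ H₂ s v * fbmKernelDeriv H₁ H₂ u v) u 0
  simp only [zero_add] at h
  rw [kKernel, min_eq_right hus.le, h, intervalIntegral.integral_congr_ae
    (ae_fbmKernelDeriv_mul_comp hH₁ hH hH₂ hu hus), intervalIntegral.integral_const_mul,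
    kappaProfile, sub_eq_add_neg 1, Real.rpow_add hu, Real.rpow_one]
  ring

theorem kappa_of_lt (hH₁ : 1 / 2 ≤ H₁) (hH : H₁ < H₂) (hH₂ : H₂ < 1) {s u : ℝ} (hu : 0 < u)
    (hus : u < s) :
    kappa H₁ H₂ s u = s ^ (2 * (H₂ - H₁) - 1) * kappaProfile H₁ H₂ (u / s) := by
  rw [kappa, if_neg hu.ne', kKernel_eq hH₁ hH hH₂ hu hus, ← mul_assoc, ← Real.rpow_add hu]
  simp

/-- Although k is symmetric, κ is not: the weight u^(2H₁-1) now meets s^(1-2H₁) instead of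
cancelling a power of u. -/
theorem kappa_of_gt (hH₁ : 1 / 2 ≤ H₁) (hH : H₁ < H₂) (hH₂ : H₂ < 1) {s u : ℝ} (hs : 0 < s)
    (hsu : s < u) : kappa H₁ H₂ s u =
      (s / u) ^ (1 - 2 * H₁) * (u ^ (2 * (H₂ - H₁) - 1) * kappaProfile H₁ H₂ (s / u)) := by
  have hu := hs.trans hsu
  rw [kappa, if_neg hu.ne', kKernel_symm, kKernel_eq hH₁ hH hH₂ hs hsu,
    Real.div_rpow hs.le hu.le, show 2 * H₁ - 1 = -(1 - 2 * H₁) by ring, Real.rpow_neg hu.le]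
  ring

theorem tendsto_kappa_zero (hH₁ : 1 / 2 ≤ H₁) (hH : H₁ < H₂) (hH₂ : H₂ < 1) {s : ℝ} (hs : 0 < s) :
    Tendsto (fun u => kappa H₁ H₂ s u) (𝓝[>] (0 : ℝ))
      (𝓝 (s ^ (2 * (H₂ - H₁) - 1) * kappaProfile H₁ H₂ 0)) := by
  have hdiv : Tendsto (fun u : ℝ => u / s) (𝓝[>] 0) (𝓝[Set.Ico 0 1] 0) := by
    refine tendsto_nhdsWithin_iff.2 ⟨?_, ?_⟩
    · have : ContinuousAt (fun u : ℝ => u / s) 0 := by fun_prop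
      simpa using this.tendsto.mono_left nhdsWithin_le_nhds
    · filter_upwards [Ioo_mem_nhdsGT hs] with u hu
      exact ⟨div_nonneg hu.1.le hs.le, (div_lt_one hs).2 hu.2⟩
  have h := ((continuousOn_kappaProfile hH₁ hH hH₂ 0 (by simp)).tendsto.comp hdiv).const_mul
    (s ^ (2 * (H₂ - H₁) - 1))
  refine h.congr' ?_
  filter_upwards [Ioo_mem_nhdsGT hs] with u hu
  exact (kappa_of_lt hH₁ hH hH₂ hu.1 hu.2).symm

theorem kappa_zero (hH₁ : 1 / 2 ≤ H₁) (hH : H₁ < H₂) (hH₂ : H₂ < 1) {s : ℝ} (hs : 0 < s) :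
    kappa H₁ H₂ s 0 = s ^ (2 * (H₂ - H₁) - 1) * kappaProfile H₁ H₂ 0 := by
  rw [kappa, if_pos rfl]
  refine Tendsto.limUnder_eq ((tendsto_kappa_zero hH₁ hH hH₂ hs).congr' ?_)
  filter_upwards [self_mem_nhdsWithin] with u hu
  rw [kappa, if_neg (ne_of_gt hu)]

theorem kappa_of_nonneg_of_lt (hH₁ : 1 / 2 ≤ H₁) (hH : H₁ < H₂) (hH₂ : H₂ < 1) {s u : ℝ}
    (hu : 0 ≤ u) (hus : u < s) :
    kappa H₁ H₂ s u = s ^ (2 * (H₂ - H₁) - 1) * kappaProfile H₁ H₂ (u / s) := by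
  rcases hu.eq_or_lt with rfl | hu
  · rw [kappa_zero hH₁ hH hH₂ hus, zero_div]
  · exact kappa_of_lt hH₁ hH hH₂ hu hus

end

/-! ### Majorant of κ and continuity in u -/

noncomputable section

/-- A function dominating `κ(·, u)` on `[0, T]`. -/
def kappaMajorant (H₁ H₂ C T u s : ℝ) : ℝ :=
  if s < u then
    C * u ^ (2 * (H₂ - H₁) - 1) * ((1 - s / u) ^ (H₂ - H₁ - 1) * (s / u) ^ (1 - 2 * H₁))
  else C * T ^ (H₂ - H₁) * (s - u) ^ (H₂ - H₁ - 1)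

variable {H₁ H₂ : ℝ}

theorem exists_kappa_le_kappaMajorant (hH₁ : 1 / 2 ≤ H₁) (hH : H₁ < H₂) (hH₂ : H₂ < 1) (T : ℝ) :
    ∃ C, ∀ s u, 0 < s → s ≤ T → 0 ≤ u → s ≠ u →
      0 ≤ kappa H₁ H₂ s u ∧ kappa H₁ H₂ s u ≤ kappaMajorant H₁ H₂ C T u s := by
  obtain ⟨C, hC, hb⟩ := exists_kappaProfile_le hH₁ hH hH₂
  refine ⟨C, fun s u hs hsT hu hne => ?_⟩
  rcases lt_or_gt_of_ne hne with h | h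
  · have hu' := hs.trans h
    obtain ⟨h1, h2⟩ := hb (s / u) (div_nonneg hs.le hu) ((div_lt_one hu').2 h)
    have h3 : 0 ≤ (s / u) ^ (1 - 2 * H₁) := Real.rpow_nonneg (div_nonneg hs.le hu) _
    have h4 : 0 ≤ u ^ (2 * (H₂ - H₁) - 1) := Real.rpow_nonneg hu _
    rw [kappa_of_gt hH₁ hH hH₂ hs h, kappaMajorant, if_pos h]
    refine ⟨mul_nonneg h3 (mul_nonneg h4 h1), ?_⟩
    calc _ ≤ (s / u) ^ (1 - 2 * H₁) *
          (u ^ (2 * (H₂ - H₁) - 1) * (C * (1 - s / u) ^ (H₂ - H₁ - 1))) :=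
          mul_le_mul_of_nonneg_left (mul_le_mul_of_nonneg_left h2 h4) h3
      _ = _ := by ring
  · obtain ⟨h1, h2⟩ := hb (u / s) (div_nonneg hu hs.le) ((div_lt_one hs).2 h)
    have h4 : 0 ≤ s ^ (2 * (H₂ - H₁) - 1) := Real.rpow_nonneg hs.le _
    have h5 : 0 ≤ (s - u) ^ (H₂ - H₁ - 1) := Real.rpow_nonneg (by linarith) _
    have h6 : s ^ (H₂ - H₁) ≤ T ^ (H₂ - H₁) := Real.rpow_le_rpow hs.le hsT (by linarith)
    rw [kappa_of_nonneg_of_lt hH₁ hH hH₂ hu h, kappaMajorant, if_neg h.not_gt]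
    refine ⟨mul_nonneg h4 h1, ?_⟩
    calc _ ≤ s ^ (2 * (H₂ - H₁) - 1) * (C * (1 - u / s) ^ (H₂ - H₁ - 1)) :=
          mul_le_mul_of_nonneg_left h2 h4
      -- Rewriting 1 - u/s as (s-u)/s leaves a positive power of s, which can be replaced by one of
      -- T.
      _ = C * s ^ (H₂ - H₁) * (s - u) ^ (H₂ - H₁ - 1) := by
          rw [show 1 - u / s = (s - u) / s by field_simp, Real.div_rpow (by linarith) hs.le,
            show 2 * (H₂ - H₁) - 1 = (H₂ - H₁) + (H₂ - H₁ - 1) by ring, Real.rpow_add hs]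
          have : s ^ (H₂ - H₁ - 1) ≠ 0 := (Real.rpow_pos_of_pos hs _).ne'
          field_simp
      _ ≤ _ := mul_le_mul_of_nonneg_right (mul_le_mul_of_nonneg_left h6 hC) h5

/-- The majorant is integrable, with an integral that depends continuously on the parameter. -/
theorem exists_integral_kappaMajorant (hH : H₁ < H₂) (hH₂ : H₂ < 1)
    (C T : ℝ) : ∃ B, ∀ u, 0 ≤ u → u ≤ T →
      IntervalIntegrable (kappaMajorant H₁ H₂ C T u) volume 0 T ∧
      ∫ s in (0 : ℝ)..T, kappaMajorant H₁ H₂ C T u s =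
        C * u ^ (2 * (H₂ - H₁)) * B + C * T ^ (H₂ - H₁) * ((T - u) ^ (H₂ - H₁) / (H₂ - H₁)) := by
  have hB := intervalIntegrable_one_sub_rpow_mul_rpow (p := H₂ - H₁ - 1) (q := 1 - 2 * H₁)
    (by linarith) (by linarith)
  refine ⟨∫ r in (0 : ℝ)..1, (1 - r) ^ (H₂ - H₁ - 1) * r ^ (1 - 2 * H₁), fun u hu huT => ?_⟩
  have hleft : IntervalIntegrable (kappaMajorant H₁ H₂ C T u) volume 0 u ∧
      ∫ s in (0 : ℝ)..u, kappaMajorant H₁ H₂ C T u s = C * u ^ (2 * (H₂ - H₁)) *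
        ∫ r in (0 : ℝ)..1, (1 - r) ^ (H₂ - H₁ - 1) * r ^ (1 - 2 * H₁) := by
    rcases hu.eq_or_lt with rfl | hu
    -- At u = 0 the interval is degenerate, and the formula persists because 0^(2(H₂-H₁)) = 0.
    · simp [Real.zero_rpow (by linarith : 2 * (H₂ - H₁) ≠ 0)]
    have hcomp : ∀ᵐ r : ℝ, r ∈ Set.uIoc 0 1 → kappaMajorant H₁ H₂ C T u (u * r) =
        C * u ^ (2 * (H₂ - H₁) - 1) * ((1 - r) ^ (H₂ - H₁ - 1) * r ^ (1 - 2 * H₁)) := by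
      filter_upwards [ae_ne_volume 1] with r hr1 hr
      rw [Set.uIoc_of_le zero_le_one] at hr
      rw [kappaMajorant, if_pos (mul_lt_of_lt_one_right hu (lt_of_le_of_ne hr.2 hr1)),
        mul_div_cancel_left₀ _ hu.ne']
    constructor
    · have h : IntervalIntegrable (kappaMajorant H₁ H₂ C T u) volume 0 (0 + u) := by
        refine intervalIntegrable_of_comp_add_mul hu.ne' ?_
        simp only [zero_add]
        refine (hB.const_mul (C * u ^ (2 * (H₂ - H₁) - 1))).congr_ae
          ((ae_restrict_iff' measurableSet_uIoc).2 ?_)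
        filter_upwards [hcomp] with r hr hr'
        exact (hr hr').symm
      simpa using h
    · have h := integral_eq_mul_integral_comp_add_mul (kappaMajorant H₁ H₂ C T u) u 0
      simp only [zero_add] at h
      rw [h, intervalIntegral.integral_congr_ae hcomp, intervalIntegral.integral_const_mul,
        Real.rpow_sub_one hu.ne']
      field_simp
  have hright : IntervalIntegrable (kappaMajorant H₁ H₂ C T u) volume u T ∧
      ∫ s in u..T, kappaMajorant H₁ H₂ C T u s =
        C * T ^ (H₂ - H₁) * ((T - u) ^ (H₂ - H₁) / (H₂ - H₁)) := by
    have heq : ∀ s ∈ Set.uIcc u T, kappaMajorant H₁ H₂ C T u s =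
        C * T ^ (H₂ - H₁) * (s - u) ^ (H₂ - H₁ - 1) := by
      intro s hs
      rw [Set.uIcc_of_le huT] at hs
      rw [kappaMajorant, if_neg hs.1.not_gt]
    constructor
    · have h := (intervalIntegral.intervalIntegrable_rpow' (a := 0) (b := T - u)
        (by linarith : -1 < H₂ - H₁ - 1)).comp_sub_right u
      simp only [zero_add, sub_add_cancel] at h
      refine (h.const_mul (C * T ^ (H₂ - H₁))).congr fun s hs => ?_
      exact (heq s (Set.uIoc_subset_uIcc hs)).symm
    · rw [intervalIntegral.integral_congr heq, intervalIntegral.integral_const_mul,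
        intervalIntegral.integral_comp_sub_right (fun x => x ^ (H₂ - H₁ - 1)) u,
        integral_rpow (Or.inl (by linarith))]
      simp [Real.zero_rpow (by linarith : H₂ - H₁ ≠ 0)]
  refine ⟨hleft.1.trans hright.1, ?_⟩
  rw [← intervalIntegral.integral_add_adjacent_intervals hleft.1 hright.1, hleft.2, hright.2]

theorem ae_restrict_Ioc_mem_and_ne (T u : ℝ) :
    ∀ᵐ s ∂volume.restrict (Set.Ioc 0 T), 0 < s ∧ s ≤ T ∧ s ≠ u := by
  refine (ae_restrict_iff' measurableSet_Ioc).2 ?_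
  filter_upwards [ae_ne_volume u] with s hs hs'
  exact ⟨hs'.1, hs'.2, hs⟩

theorem aestronglyMeasurable_kappa (hH₁ : 1 / 2 ≤ H₁) (hH : H₁ < H₂) (hH₂ : H₂ < 1) (T : ℝ)
    {u : ℝ} (hu : 0 ≤ u) :
    AEStronglyMeasurable (fun s => kappa H₁ H₂ s u) (volume.restrict (Set.Ioc 0 T)) := by
  have hg := measurable_kappaProfile (H₁ := H₁) (H₂ := H₂)
  have hm : Measurable fun s : ℝ =>
      if u < s then s ^ (2 * (H₂ - H₁) - 1) * kappaProfile H₁ H₂ (u / s)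
      else (s / u) ^ (1 - 2 * H₁) * (u ^ (2 * (H₂ - H₁) - 1) * kappaProfile H₁ H₂ (s / u)) :=
    Measurable.ite measurableSet_Ioi (by fun_prop) (by fun_prop)
  refine hm.aestronglyMeasurable.congr ?_
  filter_upwards [ae_restrict_Ioc_mem_and_ne T u] with s hs
  rcases lt_or_gt_of_ne hs.2.2 with h | h
  · rw [if_neg h.not_gt, kappa_of_gt hH₁ hH hH₂ hs.1 h]
  · rw [if_pos h, kappa_of_nonneg_of_lt hH₁ hH hH₂ hu h]

/-- Continuity is relative to u ≥ 0, since the scaling formulas say nothing about negative u. At u =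
0 it comes from continuity of `kappaProfile` at 0. -/
theorem continuousWithinAt_kappa (hH₁ : 1 / 2 ≤ H₁) (hH : H₁ < H₂) (hH₂ : H₂ < 1) {s u : ℝ}
    (hs : 0 < s) (hu : 0 ≤ u) (hne : s ≠ u) :
    ContinuousWithinAt (fun u => kappa H₁ H₂ s u) (Set.Ici 0) u := by
  have hg := continuousOn_kappaProfile hH₁ hH hH₂
  rcases lt_or_gt_of_ne hne with h | h
  · have hu' : 0 < u := hs.trans h
    refine ContinuousAt.continuousWithinAt ?_
    have h1 : ContinuousAt (fun u : ℝ => s / u) u := continuousAt_const.div continuousAt_id hu'.ne'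
    have h2 : ContinuousAt (kappaProfile H₁ H₂) (s / u) :=
      hg.continuousAt (Ico_mem_nhds (div_pos hs hu') ((div_lt_one hu').2 h))
    have h3 : ContinuousAt (fun u : ℝ => kappaProfile H₁ H₂ (s / u)) u :=
      ContinuousAt.comp (f := fun u : ℝ => s / u) h2 h1
    refine ((h1.rpow_const (p := 1 - 2 * H₁) (Or.inl (div_pos hs hu').ne')).mul
      ((continuousAt_id.rpow_const (p := 2 * (H₂ - H₁) - 1) (Or.inl hu'.ne')).mul h3)).congr ?_
    filter_upwards [Ioi_mem_nhds h] with w hw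
    exact (kappa_of_gt hH₁ hH hH₂ hs hw).symm
  · have hdiv : Tendsto (fun w : ℝ => w / s) (𝓝[Set.Ici 0] u) (𝓝[Set.Ico 0 1] (u / s)) := by
      refine tendsto_nhdsWithin_iff.2 ⟨?_, ?_⟩
      · have : ContinuousAt (fun w : ℝ => w / s) u := by fun_prop
        exact this.tendsto.mono_left nhdsWithin_le_nhds
      · filter_upwards [self_mem_nhdsWithin, mem_nhdsWithin_of_mem_nhds (Iio_mem_nhds h)]
          with w hw hw'
        exact ⟨div_nonneg hw hs.le, (div_lt_one hs).2 hw'⟩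
    have hlim := ((hg (u / s) ⟨div_nonneg hu hs.le, (div_lt_one hs).2 h⟩).tendsto.comp
      hdiv).const_mul (s ^ (2 * (H₂ - H₁) - 1))
    rw [← kappa_of_nonneg_of_lt hH₁ hH hH₂ hu h] at hlim
    refine hlim.congr' ?_
    filter_upwards [self_mem_nhdsWithin, mem_nhdsWithin_of_mem_nhds (Iio_mem_nhds h)]
      with w hw hw'
    exact (kappa_of_nonneg_of_lt hH₁ hH hH₂ hw hw').symm

theorem continuousAt_kappaMajorant {C T s u : ℝ} (hs : 0 < s) (hne : s ≠ u) :
    ContinuousAt (fun u => kappaMajorant H₁ H₂ C T u s) u := by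
  rcases lt_or_gt_of_ne hne with h | h
  · have hu' : 0 < u := hs.trans h
    have h1 : ContinuousAt (fun u : ℝ => s / u) u := continuousAt_const.div continuousAt_id hu'.ne'
    have h2 : 0 < 1 - s / u := by linarith [(div_lt_one hu').2 h]
    have h3 : ContinuousAt (fun u : ℝ => (1 - s / u) ^ (H₂ - H₁ - 1)) u :=
      (continuousAt_const.sub h1).rpow_const (Or.inl h2.ne')
    have h4 : ContinuousAt (fun u : ℝ => (s / u) ^ (1 - 2 * H₁)) u :=
      h1.rpow_const (Or.inl (div_pos hs hu').ne')
    have h5 : ContinuousAt (fun u : ℝ => u ^ (2 * (H₂ - H₁) - 1)) u :=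
      continuousAt_id.rpow_const (Or.inl hu'.ne')
    refine ((continuousAt_const (y := C)).mul h5 |>.mul (h3.mul h4)).congr ?_
    filter_upwards [Ioi_mem_nhds h] with w hw
    rw [kappaMajorant, if_pos (show s < w from hw)]
    rfl
  · have h3 : ContinuousAt (fun u : ℝ => (s - u) ^ (H₂ - H₁ - 1)) u :=
      ContinuousAt.rpow_const (by fun_prop) (Or.inl (sub_pos.2 h).ne')
    refine ((continuousAt_const (y := C * T ^ (H₂ - H₁))).mul h3).congr ?_
    filter_upwards [Iio_mem_nhds h] with w hw
    rw [kappaMajorant, if_neg (not_lt.2 (le_of_lt hw))]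
    rfl

end

/-! ### The compact operator -/

theorem lemma3 (H₁ H₂ T : ℝ) (hH₁ : 1 / 2 ≤ H₁) (hH : H₁ < H₂) (hH₂ : H₂ < 1) (hT : 0 < T) :
    -- the kernel `K_{H₁,H₂}` and its derivative in the first variable are well defined
    (∀ v t : ℝ, 0 < v → v < t →
      IntervalIntegrable (fbmIntegrand H₁ H₂ t v) volume v t ∧
        DifferentiableAt ℝ (fun τ : ℝ => fbmKernel H₁ H₂ τ v) t) ∧
    -- the integral defining `k(s,u)` converges off the diagonal
    (∀ s u : ℝ, 0 < s → 0 < u → s ≠ u →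
      IntervalIntegrable (fun v : ℝ => fbmKernelDeriv H₁ H₂ s v * fbmKernelDeriv H₁ H₂ u v)
        volume 0 (min s u)) ∧
    -- the limit defining `κ(s,0)` exists
    (∀ s : ℝ, 0 < s →
      Tendsto (fun u : ℝ => kappa H₁ H₂ s u) (𝓝[>] (0 : ℝ)) (𝓝 (kappa H₁ H₂ s 0))) ∧
    -- `κ(·,u)` is integrable on `[0,T]` for every `u ∈ [0,T]`
    (∀ u : Set.Icc (0 : ℝ) T,
      IntervalIntegrable (fun s : ℝ => kappa H₁ H₂ s (u : ℝ)) volume 0 T) ∧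
    -- `κ` generates a compact operator from `C[0,T]` to `C[0,T]`
    ∃ A : C(Set.Icc (0 : ℝ) T, ℝ) →L[ℝ] C(Set.Icc (0 : ℝ) T, ℝ),
      (∀ (x : C(Set.Icc (0 : ℝ) T, ℝ)) (u : Set.Icc (0 : ℝ) T),
        A x u = ∫ s in (0 : ℝ)..T, kappa H₁ H₂ s (u : ℝ) * Set.IccExtend hT.le x s) ∧
      IsCompactOperator A := by
  obtain ⟨C, hC⟩ := exists_kappa_le_kappaMajorant hH₁ hH hH₂ T
  obtain ⟨B, hB⟩ := exists_integral_kappaMajorant hH hH₂ C T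
  have hM : ∀ u : Set.Icc (0 : ℝ) T,
      Integrable (kappaMajorant H₁ H₂ C T u) (volume.restrict (Set.Ioc 0 T)) := fun u =>
    (intervalIntegrable_iff_integrableOn_Ioc_of_le hT.le).1 (hB u u.2.1 u.2.2).1
  have hle : ∀ u : Set.Icc (0 : ℝ) T, ∀ᵐ s ∂volume.restrict (Set.Ioc 0 T),
      0 ≤ kappa H₁ H₂ s u ∧ kappa H₁ H₂ s u ≤ kappaMajorant H₁ H₂ C T u s := by
    intro u
    filter_upwards [ae_restrict_Ioc_mem_and_ne T u] with s hs
    exact hC s u hs.1 hs.2.1 u.2.1 hs.2.2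
  have hK : ∀ u : Set.Icc (0 : ℝ) T,
      Integrable (fun s => kappa H₁ H₂ s u) (volume.restrict (Set.Ioc 0 T)) := by
    intro u
    refine (hM u).mono' (aestronglyMeasurable_kappa hH₁ hH hH₂ T u.2.1) ?_
    filter_upwards [hle u] with s hs
    rw [Real.norm_of_nonneg hs.1]
    exact hs.2
  refine ⟨fun v t hv hvt => ⟨intervalIntegrable_fbmIntegrand (by linarith) (by linarith) hH hv hvt,
    (hasDerivAt_fbmKernel (by linarith) (by linarith) hH (by linarith) hv hvt).differentiableAt⟩,
    fun s u hs hu hne => ?_, fun s hs => ?_,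
    fun u => (intervalIntegrable_iff_integrableOn_Ioc_of_le hT.le).2 (hK u), ?_⟩
  · rcases lt_or_gt_of_ne hne with h | h
    · rw [min_eq_left h.le]
      simpa only [mul_comm] using intervalIntegrable_fbmKernelDeriv_mul hH₁ hH hH₂ hs h
    · rw [min_eq_right h.le]
      exact intervalIntegrable_fbmKernelDeriv_mul hH₁ hH hH₂ hu h
  · rw [kappa_zero hH₁ hH hH₂ hs]
    exact tendsto_kappa_zero hH₁ hH hH₂ hs
  have hcont : ∀ u₀ : Set.Icc (0 : ℝ) T, Tendsto
      (fun u : Set.Icc (0 : ℝ) T =>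
        ∫ s in Set.Ioc 0 T, |kappa H₁ H₂ s u - kappa H₁ H₂ s u₀|) (𝓝 u₀) (𝓝 0) := by
    intro u₀
    refine tendsto_integral_abs_sub_of_le
      (K := fun (u : Set.Icc (0 : ℝ) T) s => kappa H₁ H₂ s u)
      (M := fun (u : Set.Icc (0 : ℝ) T) s => kappaMajorant H₁ H₂ C T u s) hK hM
      (fun u => (hle u).mono fun s hs => hs.1) (fun u => (hle u).mono fun s hs => hs.2) ?_ ?_ ?_
    · filter_upwards [ae_restrict_Ioc_mem_and_ne T u₀] with s hs
      refine (continuousWithinAt_kappa hH₁ hH hH₂ hs.1 u₀.2.1 hs.2.2).tendsto.comp ?_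
      exact tendsto_nhdsWithin_iff.2
        ⟨continuous_subtype_val.continuousAt, Eventually.of_forall fun u => u.2.1⟩
    · filter_upwards [ae_restrict_Ioc_mem_and_ne T u₀] with s hs
      exact (continuousAt_kappaMajorant hs.1 hs.2.2).comp continuous_subtype_val.continuousAt
    -- In the closed form u and T - u carry positive exponents, so continuity holds up to both
    -- endpoints.
    · have heq : ∀ u : Set.Icc (0 : ℝ) T, ∫ s in Set.Ioc 0 T, kappaMajorant H₁ H₂ C T u s =
          C * (u : ℝ) ^ (2 * (H₂ - H₁)) * B +
            C * T ^ (H₂ - H₁) * ((T - u) ^ (H₂ - H₁) / (H₂ - H₁)) := by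
        intro u
        rw [← intervalIntegral.integral_of_le hT.le]
        exact (hB u u.2.1 u.2.2).2
      simp_rw [heq]
      have h1 : Continuous fun u : Set.Icc (0 : ℝ) T => (u : ℝ) ^ (2 * (H₂ - H₁)) :=
        continuous_subtype_val.rpow_const fun _ => Or.inr (by linarith)
      have h2 : Continuous fun u : Set.Icc (0 : ℝ) T => (T - (u : ℝ)) ^ (H₂ - H₁) :=
        Continuous.rpow_const (by fun_prop) fun _ => Or.inr (by linarith)
      exact Continuous.continuousAt (by fun_prop)
  -- With ι the projection onto [0,T], x ∘ ι is `Set.IccExtend` by definition.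
  obtain ⟨A, hA, hAc⟩ := exists_isCompactOperator_of_tendsto_integral_abs_sub
    (ι := Set.projIcc 0 T hT.le) continuous_projIcc.measurable hK hcont
  refine ⟨A, fun x u => ?_, hAc⟩
  rw [hA, intervalIntegral.integral_of_le hT.le]
  rfl
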